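/- Conventions. A vertex operator algebra (VOA) $V$ over $\mathbb{C}$ of central charge $c\in\mathbb{C}$ has a vacuum vector $\mathbf 1\neq 0$, a Virasoro vector $\omega\neq0$ and fields $Y(v,z)=\sum_{n\in\mathbb{Z}}v_{(n)}z^{-n-1}$. The operators $L_n=\omega_{(n+1)}$ satisfy the Virasoro relations of central charge $c$. The space $V=\bigoplus_{n\ge 0}V_n$ is graded by the eigenvalues of $L_0$, with $\dim V_n<\infty$ and $V_0=\mathbb{C}\mathbf 1$. It is also assumed that $V$, as a module for the Virasoro algebra, is a direct sum of highest weight modules $M_i$, i.e. quotients of Verma modules $M(c,h_i)$ with $h_i\in\mathbb{Z}_{\ge0}$. For $k\ge 0$ let $\overline M(k)$ be the sum of those $M_i$ with $h_i=k$, and let $\pi:V\to\overline M(0)$ be the projection with kernel $\bigoplus_{k>0}\overline M(k)$. A $V$-module $W$ is an ordinary module: it is the direct sum of its $L_0$-eigenspaces $W_\lambda$, $\lambda\in\mathbb{C}$, all $W_\lambda$ are finite-dimensional, and for each $\lambda$ one has $W_{\lambda+n}=0$ for all sufficiently small $n\in\mathbb{Z}$. It has conformal weight $h\in\mathbb{C}$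 if $W=\bigoplus_{n\ge0}W_{h+n}$ and $W_h\ne0$. For $v\in V_n$ put $\mathrm{o}(v)=v_{(n-1)}$, which maps each $W_\lambda$ to itself. The space $W_\lambda$ is a conformal $t$-design if $\mathrm{tr}|_{W_\lambda}\mathrm{o}(v)=\mathrm{tr}|_{W_\lambda}\mathrm{o}(\pi(v))$ for all $v\in V_n$ and all $0\le n\le t$. Proposition. Let $V$ be a VOA as above of central charge $$c\neq -24,\ -15,\ -\tfrac{44}{5},\ \tfrac{34}{35},\ 1,$$ and let $\omega'\in V_2$ be such that $\omega'$ and $\omega-\omega'\in V_2$ generate two commuting Virasoro vertex operator algebras of central charge $e$ and $c-e$, respectively, where $$e,\ c-e\neq -\tfrac{68}{7},\ -\tfrac{22}{5},\ 0.$$ If $e=\tfrac12$, assume moreover that the vertex subalgebra generated by $\omega'$ is simple; if $e=c-\tfrac12$, assume moreover that the vertex subalgebra generated by $\omega-\omega'$ is simple. If there exists a $V$-module $W$ of conformal weight $h\neq0$ whose lowest degree part $W_h$ is a conformal $6$-design, then $$4+7c+c^2-124h-31ch+248h^2=0.$$ -/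

import Mathlib

open VertexOperator

noncomputable section

section Axioms

variable {V W : Type*} [AddCommGroup V] [Module ℂ V] [AddCommGroup W] [Module ℂ W]

/-- The Borcherds (Jacobi) identity in components, for a vertex algebra structure `Y` on `V`
acting on `W` through `YW`:
`∑ᵢ C(m,i) (u₍ₙ₊ᵢ₎v)₍ₘ₊ₖ₋ᵢ₎ w
  = ∑ᵢ (-1)ⁱ C(n,i) (u₍ₘ₊ₙ₋ᵢ₎ v₍ₖ₊ᵢ₎ w - (-1)ⁿ v₍ₙ₊ₖ₋ᵢ₎ u₍ₘ₊ᵢ₎ w)`.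
Only finitely many terms on either side are nonzero, because `VertexOperator`s take values in
Laurent series. For `m = 0` this is the associativity relation. -/
def BorcherdsIdentity (Y : V →ₗ[ℂ] VertexOperator ℂ V) (YW : V →ₗ[ℂ] VertexOperator ℂ W) : Prop :=
  ∀ (u v : V) (w : W) (m n k : ℤ),
    ∑ᶠ i : ℕ, Ring.choose m i • ((YW (((Y u)[[n + i]]) v))[[m + k - i]]) w =
      ∑ᶠ i : ℕ, ((-1) ^ i * Ring.choose n i) •
        (((YW u)[[m + n - i]]) (((YW v)[[k + i]]) w) -
          (n.negOnePow : ℤ) • ((YW v)[[n + k - i]]) (((YW u)[[m + i]]) w))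

/-- The operators `L n` satisfy the Virasoro relations with `C = c · id`. -/
def VirasoroRelations (L : ℤ → Module.End ℂ V) (c : ℂ) : Prop :=
  ∀ m n : ℤ, L m * L n - L n * L m =
    ((m : ℂ) - n) • L (m + n) + if m + n = 0 then (((m : ℂ) ^ 3 - m) / 12 * c) • 1 else 0

end Axioms

/-- A vertex operator algebra over `ℂ` with `V = ⨁_{n ≥ 0} V_n`, `dim V_n < ∞` and
`V_0 = ℂ · 1`. The coefficient `v₍ₙ₎` of `Y(v,z) = ∑ v₍ₙ₎ z^{-n-1}` is `(Y v)[[n]]`, and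
`L_n = ω₍ₙ₊₁₎`. -/
structure VOA (V : Type*) [AddCommGroup V] [Module ℂ V] where
  /-- the state-field correspondence -/
  Y : V →ₗ[ℂ] VertexOperator ℂ V
  /-- the vacuum vector -/
  vac : V
  /-- the Virasoro vector -/
  conf : V
  /-- the central charge -/
  c : ℂ
  vac_ne_zero : vac ≠ 0
  conf_ne_zero : conf ≠ 0
  vac_mode : ∀ n : ℤ, (Y vac)[[n]] = if n = -1 then 1 else 0
  creation : ∀ v : V, ((Y v)[[-1]]) vac = v
  creation_nonneg : ∀ (v : V) (n : ℤ), 0 ≤ n → ((Y v)[[n]]) vac = 0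
  borcherds : BorcherdsIdentity Y Y
  virasoro : VirasoroRelations (fun n => (Y conf)[[n + 1]]) c
  derivative : ∀ (v : V) (n : ℤ), (Y (((Y conf)[[0]]) v))[[n]] = (-(n : ℂ)) • (Y v)[[n - 1]]
  -- `V` is the sum of the `L_0`-eigenspaces to the eigenvalues `0, 1, 2, …`
  -- (eigenspaces are automatically independent)
  grading : (⨆ n : ℕ, Module.End.eigenspace ((Y conf)[[1]]) (n : ℂ)) = ⊤
  finiteDimensional : ∀ n : ℕ,
    FiniteDimensional ℂ (Module.End.eigenspace ((Y conf)[[1]]) (n : ℂ))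
  degree_zero : Module.End.eigenspace ((Y conf)[[1]]) 0 = Submodule.span ℂ {vac}

namespace VOA

variable {V : Type*} [AddCommGroup V] [Module ℂ V] (A : VOA V)

/-- The mode `v₍ₙ₎`. -/
abbrev mode (v : V) (n : ℤ) : Module.End ℂ V := (A.Y v)[[n]]

/-- The Virasoro operators `L_n = ω₍ₙ₊₁₎`. -/
abbrev L (n : ℤ) : Module.End ℂ V := A.mode A.conf (n + 1)

/-- The degree `n` part `V_n`. -/
def degreePart (n : ℕ) : Submodule ℂ V := Module.End.eigenspace (A.L 0) (n : ℂ)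

/-- `x` is a Virasoro element of central charge `e`: the modes `x₍ₙ₊₁₎` satisfy the Virasoro
relations of central charge `e`. -/
def IsVirasoroElement (x : V) (e : ℂ) : Prop :=
  VirasoroRelations (fun n => A.mode x (n + 1)) e

/-- The vertex subalgebra generated by `S`: the smallest subspace that contains `1` and `S` and is
closed under all products `u₍ₙ₎v`. -/
def generatedBy (S : Set V) : Submodule ℂ V :=
  sInf {U | A.vac ∈ U ∧ S ⊆ U ∧ ∀ u ∈ U, ∀ v ∈ U, ∀ n : ℤ, A.mode u n v ∈ U}

/-- Two vertex subalgebras commute: all their modes commute as operators on `V`. -/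
def Commuting (U₁ U₂ : Submodule ℂ V) : Prop :=
  ∀ u ∈ U₁, ∀ v ∈ U₂, ∀ m n : ℤ, Commute (A.mode u m) (A.mode v n)

/-- A vertex subalgebra `U` is simple: it is irreducible as a module over itself. -/
def IsSimpleSubalgebra (U : Submodule ℂ V) : Prop :=
  U ≠ ⊥ ∧ ∀ I : Submodule ℂ V, I ≤ U →
    (∀ u ∈ U, ∀ w ∈ I, ∀ n : ℤ, A.mode u n w ∈ I) → I = ⊥ ∨ I = U

/-- The Virasoro submodule of `V` generated by `v`. -/
def virasoroSpan (v : V) : Submodule ℂ V :=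
  sInf {U | v ∈ U ∧ ∀ n : ℤ, ∀ w ∈ U, A.L n w ∈ U}

/-- A decomposition `V = ⨁ᵢ Mᵢ` as a Virasoro module into highest weight modules, that is,
quotients of Verma modules `M(c, hᵢ)` with `hᵢ ∈ ℤ_{≥ 0}`: each `Mᵢ` is generated by a nonzero
highest weight vector of weight `hᵢ`. -/
structure HighestWeightDecomposition (ι : Type*) where
  hwVector : ι → V
  weight : ι → ℕ
  hwVector_ne_zero : ∀ i, hwVector i ≠ 0
  L_zero_hwVector : ∀ i, A.L 0 (hwVector i) = (weight i : ℂ) • hwVector i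
  L_pos_hwVector : ∀ (i : ι) (n : ℤ), 0 < n → A.L n (hwVector i) = 0
  independent : iSupIndep fun i => A.virasoroSpan (hwVector i)
  spanning : (⨆ i, A.virasoroSpan (hwVector i)) = ⊤

variable {A}

theorem L_mem_virasoroSpan {v w : V} (n : ℤ) (hw : w ∈ A.virasoroSpan v) :
    A.L n w ∈ A.virasoroSpan v := by
  rw [virasoroSpan, Submodule.mem_sInf] at hw ⊢
  intro U hU
  exact hU.2 n w (hw U hU)

namespace HighestWeightDecomposition

variable {ι : Type*} (D : A.HighestWeightDecomposition ι)

/-- The component `M̄(k)`: the sum of the highest weight modules `Mᵢ` of highest weight `k`. -/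
def component (k : ℕ) : Submodule ℂ V :=
  ⨆ i ∈ {i | D.weight i = k}, A.virasoroSpan (D.hwVector i)

/-- `⨁_{k > 0} M̄(k)`. -/
def positivePart : Submodule ℂ V := ⨆ k ∈ {k : ℕ | 0 < k}, D.component k

theorem positivePart_eq :
    D.positivePart = ⨆ i ∈ {i | 0 < D.weight i}, A.virasoroSpan (D.hwVector i) := by
  apply le_antisymm
  · refine iSup₂_le fun k hk => iSup₂_le fun i hi => ?_
    have hi' : i ∈ {i | 0 < D.weight i} := by
      simp only [Set.mem_ofPred_eq] at hi hk ⊢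
      omega
    exact le_iSup₂ (f := fun i (_ : i ∈ {i | 0 < D.weight i}) => A.virasoroSpan (D.hwVector i))
      i hi'
  · refine iSup₂_le fun i hi => ?_
    refine le_trans ?_ (le_iSup₂ (f := fun k (_ : k ∈ {k : ℕ | 0 < k}) => D.component k)
      (D.weight i) hi)
    exact le_iSup₂ (f := fun j (_ : j ∈ {j | D.weight j = D.weight i}) =>
      A.virasoroSpan (D.hwVector j)) i rfl

theorem isCompl : IsCompl (D.component 0) D.positivePart := by
  rw [positivePart_eq]
  constructor
  · apply D.independent.disjoint_biSup_biSup
    rw [Set.disjoint_left]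
    intro i hi hi'
    simp only [Set.mem_ofPred_eq] at hi hi'
    omega
  · rw [codisjoint_iff, eq_top_iff, ← D.spanning]
    refine iSup_le fun i => ?_
    rcases Nat.eq_zero_or_pos (D.weight i) with h | h
    · exact le_sup_of_le_left (le_iSup₂ (f := fun i (_ : i ∈ {i | D.weight i = 0}) =>
        A.virasoroSpan (D.hwVector i)) i h)
    · exact le_sup_of_le_right (le_iSup₂ (f := fun i (_ : i ∈ {i | 0 < D.weight i}) =>
        A.virasoroSpan (D.hwVector i)) i h)

/-- The projection `π : V → V_ω = M̄(0)` with kernel `⨁_{k > 0} M̄(k)`. -/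
def proj : V →ₗ[ℂ] V := (D.component 0).projection D.positivePart D.isCompl

end HighestWeightDecomposition

end VOA

/-- An (ordinary) module `W` of the vertex operator algebra `A`: `W` is the sum of the
eigenspaces of `L_0`, these are finite-dimensional, and for every `l` one has `W_{l+n} = 0` for all
sufficiently small integers `n`. -/
structure VOAModule {V : Type*} [AddCommGroup V] [Module ℂ V] (A : VOA V)
    (W : Type*) [AddCommGroup W] [Module ℂ W] where
  /-- the action of `V` on `W` -/
  Y : V →ₗ[ℂ] VertexOperator ℂ W
  vac_mode : ∀ n : ℤ, (Y A.vac)[[n]] = if n = -1 then 1 else 0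
  borcherds : BorcherdsIdentity A.Y Y
  grading : (⨆ l : ℂ, Module.End.eigenspace ((Y A.conf)[[1]]) l) = ⊤
  finiteDimensional : ∀ l : ℂ, FiniteDimensional ℂ (Module.End.eigenspace ((Y A.conf)[[1]]) l)
  lower_bound : ∀ l : ℂ, ∃ N : ℤ, ∀ n : ℤ, n < N →
    Module.End.eigenspace ((Y A.conf)[[1]]) (l + n) = ⊥

namespace VOAModule

variable {V : Type*} [AddCommGroup V] [Module ℂ V] {A : VOA V}
  {W : Type*} [AddCommGroup W] [Module ℂ W] (M : VOAModule A W)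

/-- The mode `v₍ₙ₎` acting on `W`. -/
abbrev mode (v : V) (n : ℤ) : Module.End ℂ W := (M.Y v)[[n]]

/-- The degree `l` part `W_l`, i.e. the eigenspace of `L_0` to the eigenvalue `l`. -/
def degreePart (l : ℂ) : Submodule ℂ W := Module.End.eigenspace (M.mode A.conf 1) l

/-- `W` has conformal weight `h`: `W = ⨁_{n ≥ 0} W_{h+n}` with `W_h ≠ 0`. -/
def HasConformalWeight (h : ℂ) : Prop :=
  (⨆ n : ℕ, M.degreePart (h + n)) = ⊤ ∧ M.degreePart h ≠ ⊥

theorem translation_mode (v : V) (k : ℤ) (w : W) :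
    M.mode (A.mode A.conf 0 v) k w = (-(k : ℂ)) • M.mode v (k - 1) w := by
  have h1 : A.mode A.conf 0 v = A.mode v (-2) A.vac := by
    have h := congrArg (fun f => f A.vac) (A.derivative v (-1))
    simp only [A.creation] at h
    simpa using h
  have choose_two : ∀ i : ℕ, ((-1) ^ i * Ring.choose (-2 : ℤ) i : ℤ) = i + 1 := by
    intro i
    have h3 : ((2 : ℤ) + i - 1) = ((i + 1 : ℕ) : ℤ) := by push_cast; ring
    rw [Ring.choose_neg, h3, Ring.choose_natCast, Nat.choose_succ_self_right, Units.smul_def,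
      Int.coe_negOnePow_natCast, smul_eq_mul, ← mul_assoc, ← mul_pow]
    simp
  have hB := M.borcherds v A.vac w 0 (-2) k
  rw [finsum_eq_single _ 0 (by
    intro i hi
    rw [Ring.choose_zero_pos ℤ (Nat.pos_of_ne_zero hi), zero_smul])] at hB
  simp only [Ring.choose_zero_right, one_smul, Nat.cast_zero, add_zero, zero_add, sub_zero,
    choose_two, M.vac_mode] at hB
  rw [h1, mode, hB]
  have h2 : (((-2 : ℤ).negOnePow : ℤˣ) : ℤ) = 1 := by decide
  rw [h2]
  rcases lt_trichotomy k 0 with hk | hk | hk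
  · obtain ⟨j, rfl⟩ : ∃ j : ℕ, k = -1 - (j : ℤ) := ⟨(-1 - k).toNat, by omega⟩
    rw [finsum_eq_single _ j]
    · rw [if_pos (by omega), if_neg (by omega)]
      have : (-2 - (j : ℤ)) = -1 - (j : ℤ) - 1 := by ring
      rw [this, ← Int.cast_smul_eq_zsmul ℂ]
      simp
    · intro i hi
      rw [if_neg (by omega), if_neg (by omega)]
      simp
  · subst hk
    rw [finsum_eq_zero_of_forall_eq_zero]
    · simp
    · intro i
      rw [if_neg (by omega), if_neg (by omega)]
      simp
  · obtain ⟨j, rfl⟩ : ∃ j : ℕ, k = (j : ℤ) + 1 := ⟨(k - 1).toNat, by omega⟩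
    rw [finsum_eq_single _ j]
    · rw [if_neg (by omega), if_pos (by omega), ← Int.cast_smul_eq_zsmul ℂ]
      simp only [mode]
      simp [neg_add_rev, add_smul]
    · intro i hi
      rw [if_neg (by omega), if_neg (by omega)]
      simp

/-- `o(v) = v₍ₙ₋₁₎`, for `v ∈ V_n`, is homogeneous of degree `0`. -/
theorem mode_mem_degreePart {n : ℕ} {v : V} (hv : v ∈ A.degreePart n) {l : ℂ} :
    ∀ w ∈ M.degreePart l, M.mode v ((n : ℤ) - 1) w ∈ M.degreePart l := by
  intro w hw
  rw [degreePart, Module.End.mem_eigenspace_iff] at hw ⊢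
  have hv' : A.mode A.conf 1 v = (n : ℂ) • v := by
    rw [VOA.degreePart, Module.End.mem_eigenspace_iff] at hv
    simpa [VOA.L] using hv
  have hB := M.borcherds A.conf v w 1 0 ((n : ℤ) - 1)
  rw [finsum_eq_sum_of_support_subset (s := Finset.range 2) _ (by
      intro i hi
      by_contra hi'
      apply hi
      have : 1 < i := by simpa using hi'
      change Ring.choose (1 : ℤ) i • _ = _
      rw [show (1 : ℤ) = ((1 : ℕ) : ℤ) by simp, Ring.choose_natCast, Nat.choose_eq_zero_of_lt this]
      simp),
    finsum_eq_single _ 0 (by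
      intro i hi
      rw [Ring.choose_zero_pos ℤ (Nat.pos_of_ne_zero hi), mul_zero, zero_smul])] at hB
  have h0 := M.translation_mode v n w
  simp only [mode, VOA.mode] at h0 hv' hw ⊢
  simp [Finset.sum_range_succ, hv', hw, h0] at hB
  rw [eq_comm, sub_eq_iff_eq_add] at hB
  rw [hB]
  simp

end VOAModule

namespace VOA.HighestWeightDecomposition

variable {V : Type*} [AddCommGroup V] [Module ℂ V] {A : VOA V}
  {ι : Type*} (D : A.HighestWeightDecomposition ι)

theorem L_mem_component (k : ℕ) (n : ℤ) {w : V} (hw : w ∈ D.component k) :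
    A.L n w ∈ D.component k := by
  have : D.component k ≤ (D.component k).comap (A.L n) := by
    refine iSup₂_le fun i hi w hw => ?_
    exact (le_iSup₂ (f := fun j (_ : j ∈ {j | D.weight j = k}) =>
      A.virasoroSpan (D.hwVector j)) i hi) (L_mem_virasoroSpan n hw)
  exact this hw

theorem L_mem_positivePart (n : ℤ) {w : V} (hw : w ∈ D.positivePart) :
    A.L n w ∈ D.positivePart := by
  have : D.positivePart ≤ D.positivePart.comap (A.L n) := by
    refine iSup₂_le fun k hk w hw => ?_
    exact (le_iSup₂ (f := fun k (_ : k ∈ {k : ℕ | 0 < k}) => D.component k) k hk)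
      (D.L_mem_component k n hw)
  exact this hw

/-- The projection `π` preserves degrees. -/
theorem proj_mem_degreePart {n : ℕ} {v : V} (hv : v ∈ A.degreePart n) :
    D.proj v ∈ A.degreePart n := by
  rw [VOA.degreePart, Module.End.mem_eigenspace_iff] at hv ⊢
  obtain ⟨p, hp, q, hq, rfl⟩ : ∃ p ∈ D.component 0, ∃ q ∈ D.positivePart, p + q = v := by
    have : v ∈ D.component 0 ⊔ D.positivePart := by rw [D.isCompl.sup_eq_top]; trivial
    exact Submodule.mem_sup.mp this
  have key : ∀ a ∈ D.component 0, ∀ b ∈ D.positivePart, D.proj (a + b) = a := by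
    intro a ha b hb
    rw [proj, map_add, (Submodule.projection_apply_eq_zero_iff D.isCompl).2 hb,
      (Submodule.projection_eq_self_iff D.isCompl a).2 ha, add_zero]
  rw [key p hp q hq]
  have h := congrArg D.proj hv
  rwa [map_add, key _ (D.L_mem_component 0 0 hp) _ (D.L_mem_positivePart 0 hq), map_smul,
    key p hp q hq] at h

end VOA.HighestWeightDecomposition

namespace VOAModule

variable {V : Type*} [AddCommGroup V] [Module ℂ V] {A : VOA V}
  {W : Type*} [AddCommGroup W] [Module ℂ W] (M : VOAModule A W)

/-- The trace of `o(v) = v₍ₙ₋₁₎`, for `v ∈ V_n`, on the degree `l` part `W_l`. -/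
def traceO (l : ℂ) {n : ℕ} {v : V} (hv : v ∈ A.degreePart n) : ℂ :=
  LinearMap.trace ℂ (M.degreePart l)
    ((M.mode v ((n : ℤ) - 1)).restrict (M.mode_mem_degreePart hv))

/-- The degree `l` part `W_l` is a conformal `t`-design:
`tr|_{W_l} o(v) = tr|_{W_l} o(π(v))` for all `v ∈ V_n`, `0 ≤ n ≤ t`. -/
def IsConformalDesign {ι : Type*} (D : A.HighestWeightDecomposition ι) (l : ℂ) (t : ℕ) : Prop :=
  ∀ n : ℕ, n ≤ t → ∀ (v : V) (hv : v ∈ A.degreePart n),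
    M.traceO l hv = M.traceO l (D.proj_mem_degreePart hv)

end VOAModule

end

/-! Let `T` be the zero mode of ω' on `W_h`, and write L' for the modes of ω'. The vectors ω',
L'₋₂²1 and L'₋₃²1, of degrees 2, 4 and 6, have zero modes T, T² + 2T and 4T² + 6T
(`zeroMode_neg_two_neg_two`, `zeroMode_neg_three_neg_three`). Only the two unknowns tr T and tr T²
occur; L'₋₂³1 would bring in tr T³ as well.

The design property replaces each vector by its image under π, a combination of Virasoro descendants
of the vacuum. On the lowest degree part such descendants act as scalars, polynomials in h
(`zeroMode_conf`). So there are three linear equations for two unknowns, and eliminating tr T and tr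
T² leaves a condition on c, e and h.

The coefficients of π(v) are governed by the Gram matrices of the vacuum module: a Virasoro word
lowering the degree by n takes the same value on v ∈ V_n as on π(v) (`applyWord_proj`). The values
on v depend on e alone, because [L_m, L'_n] = [L'_m, L'_n] (`bracket_conf_of_commuting`).

The resulting condition is 4he(c-e) dim W_h times the asserted polynomial (`quadratic_relation`). It
is derived without inverting the Gram matrices, so their degeneration needs no separate treatment.
-/

open VertexOperator

noncomputable section

/-! ### Words in Virasoro operators and low degrees of the vacuum module -/

section VirasoroWords

variable {V : Type*} [AddCommGroup V] [Module ℂ V]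

/-- The mixed commutation relations `[L m, P n] = (m - n) P (m + n) + δ (m³ - m)/12 · c`. -/
def VirasoroBracket (L P : ℤ → Module.End ℂ V) (c : ℂ) : Prop :=
  ∀ (m n : ℤ) (x : V), L m (P n x) = P n (L m x) + ((m : ℂ) - n) • P (m + n) x +
    if m + n = 0 then (((m : ℂ) ^ 3 - m) / 12 * c) • x else 0

theorem VirasoroRelations.bracket {L : ℤ → Module.End ℂ V} {c : ℂ} (h : VirasoroRelations L c) :
    VirasoroBracket L L c := by
  intro m n x
  have := congrArg (fun f => f x) (h m n)
  simp only [LinearMap.sub_apply, Module.End.mul_apply, LinearMap.add_apply,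
    LinearMap.smul_apply] at this
  rw [sub_eq_iff_eq_add'] at this
  rw [this, ← add_assoc]
  split_ifs <;> simp

/-- The vector obtained by applying the operators `L n`, for `n` in a list, to `v`. -/
def applyWord (L : ℤ → Module.End ℂ V) (l : List ℤ) (v : V) : V := l.foldr (fun n x => L n x) v

theorem applyWord_cons (L : ℤ → Module.End ℂ V) (n : ℤ) (l : List ℤ) (v : V) :
    applyWord L (n :: l) v = L n (applyWord L l v) := rfl

/-- The span of the words with letters at most `-r`, and length at most `k`, applied to `v`. -/
def wordSpan (L : ℤ → Module.End ℂ V) (r : ℤ) (k : ℕ) (v : V) : Submodule ℂ V :=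
  Submodule.span ℂ {x | ∃ l : List ℤ, (∀ n ∈ l, n ≤ -r) ∧ l.length ≤ k ∧ applyWord L l v = x}

theorem wordSpan_mono (L : ℤ → Module.End ℂ V) (r : ℤ) {k k' : ℕ} (h : k ≤ k') (v : V) :
    wordSpan L r k v ≤ wordSpan L r k' v :=
  Submodule.span_mono fun _ ⟨l, h1, h2, h3⟩ => ⟨l, h1, h2.trans h, h3⟩

theorem apply_mem_wordSpan_succ (L : ℤ → Module.End ℂ V) {r : ℤ} {k : ℕ} {v x : V} {n : ℤ}
    (hn : n ≤ -r) (hx : x ∈ wordSpan L r k v) : L n x ∈ wordSpan L r (k + 1) v := by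
  have : wordSpan L r k v ≤ (wordSpan L r (k + 1) v).comap (L n) := by
    refine Submodule.span_le.2 ?_
    rintro _ ⟨l, h1, h2, rfl⟩
    exact Submodule.subset_span ⟨n :: l, by simpa [hn] using h1, by simpa using h2, rfl⟩
  exact this hx

/-- Commute `L n` to the right through the word: each commutator shortens the word, and at the end
`v` is reproduced up to a scalar. The length bound serves this induction; the letters are never
ordered. Highest weight vectors use `r = 1`, the vacuum `r = 2`. -/
theorem apply_mem_wordSpan {L : ℤ → Module.End ℂ V} {c : ℂ} (hL : VirasoroBracket L L c)
    {r : ℤ} {v : V} (hv : ∀ n, -r < n → L n v ∈ Submodule.span ℂ {v}) (k : ℕ) :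
    ∀ (n : ℤ), -r < n → ∀ x ∈ wordSpan L r k v, L n x ∈ wordSpan L r k v := by
  induction k with
  | zero =>
    intro n hn x hx
    have h0 : wordSpan L r 0 v = Submodule.span ℂ {v} := by
      rw [wordSpan]
      congr 1
      ext y
      constructor
      · rintro ⟨l, -, h2, rfl⟩
        obtain rfl : l = [] := by simpa using h2
        rfl
      · rintro rfl
        exact ⟨[], by simp, by simp, rfl⟩
    rw [h0] at hx ⊢
    obtain ⟨a, rfl⟩ := Submodule.mem_span_singleton.1 hx
    rw [map_smul]
    exact Submodule.smul_mem _ _ (hv n hn)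
  | succ k ih =>
    intro n hn x hx
    have : wordSpan L r (k + 1) v ≤ (wordSpan L r (k + 1) v).comap (L n) := by
      refine Submodule.span_le.2 ?_
      rintro _ ⟨l, h1, h2, rfl⟩
      have hm := wordSpan_mono L r (Nat.le_succ k) v
      cases l with
      | nil =>
        refine hm (ih n hn _ (Submodule.subset_span ⟨[], by simp, by simp, rfl⟩))
      | cons m l =>
        have hl : applyWord L l v ∈ wordSpan L r k v :=
          Submodule.subset_span ⟨l, fun n hn => h1 n (by simp [hn]), by simpa using h2, rfl⟩
        have hmr : m ≤ -r := h1 m (by simp)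
        rw [SetLike.mem_coe, Submodule.mem_comap, applyWord_cons, hL n m]
        refine Submodule.add_mem _ (Submodule.add_mem _ ?_ (Submodule.smul_mem _ _ ?_)) ?_
        · exact apply_mem_wordSpan_succ L hmr (ih n hn _ hl)
        · rcases le_or_gt (n + m) (-r) with h | h
          · exact apply_mem_wordSpan_succ L h hl
          · exact hm (ih _ h _ hl)
        · split_ifs
          · exact Submodule.smul_mem _ _ (hm hl)
          · exact Submodule.zero_mem _
    exact this hx

/-- Words in the modes `L n`, `n ≤ -r`, applied to `v`, span a Virasoro submodule. -/
theorem exists_mem_wordSpan_of_mem {L : ℤ → Module.End ℂ V} {c : ℂ} (hL : VirasoroBracket L L c)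
    {r : ℤ} {v : V} (hv : ∀ n, -r < n → L n v ∈ Submodule.span ℂ {v}) {x : V}
    (hx : x ∈ sInf {U : Submodule ℂ V | v ∈ U ∧ ∀ n : ℤ, ∀ w ∈ U, L n w ∈ U}) :
    ∃ k, x ∈ wordSpan L r k v := by
  have hdir : Directed (· ≤ ·) fun k => wordSpan L r k v :=
    (show Monotone fun k => wordSpan L r k v from
      fun _ _ h => wordSpan_mono L r h v).directed_le
  have hmem := Submodule.mem_sInf.1 hx (⨆ k, wordSpan L r k v) ⟨?_, ?_⟩
  · exact (Submodule.mem_iSup_of_directed _ hdir).1 hmem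
  · exact (Submodule.mem_iSup_of_directed _ hdir).2
      ⟨0, Submodule.subset_span ⟨[], by simp, by simp, rfl⟩⟩
  · intro n w hw
    obtain ⟨k, hk⟩ := (Submodule.mem_iSup_of_directed _ hdir).1 hw
    rcases le_or_gt n (-r) with h | h
    · exact (Submodule.mem_iSup_of_directed _ hdir).2 ⟨k + 1, apply_mem_wordSpan_succ L h hk⟩
    · exact (Submodule.mem_iSup_of_directed _ hdir).2 ⟨k, apply_mem_wordSpan hL hv k n h _ hk⟩

theorem VirasoroBracket.apply_mem_eigenspace {L P : ℤ → Module.End ℂ V} {c : ℂ}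
    (h : VirasoroBracket L P c) {t : ℂ} {x : V} (hx : x ∈ (L 0).eigenspace t) (n : ℤ) :
    P n x ∈ (L 0).eigenspace (t - n) := by
  rw [Module.End.mem_eigenspace_iff] at hx ⊢
  rw [h 0 n x, hx]
  simp only [map_smul, Int.cast_zero, zero_sub, zero_add]
  split_ifs <;> simp <;> module

theorem applyWord_mem_eigenspace {L : ℤ → Module.End ℂ V} {c : ℂ} (hL : VirasoroBracket L L c)
    {t : ℂ} {v : V} (hv : v ∈ (L 0).eigenspace t) (l : List ℤ) :
    applyWord L l v ∈ (L 0).eigenspace (t - (l.sum : ℤ)) := by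
  induction l with
  | nil => simpa [applyWord] using hv
  | cons n l ih =>
    rw [applyWord_cons, List.sum_cons]
    convert hL.apply_mem_eigenspace ih n using 2
    push_cast
    ring

/-- A homogeneous element of the span of words is in the span of the words of its weight. -/
theorem mem_span_applyWord_of_mem_eigenspace {L : ℤ → Module.End ℂ V} {c : ℂ}
    (hL : VirasoroBracket L L c) {r : ℤ} {k : ℕ} {t : ℂ} {v x : V}
    (hv : v ∈ (L 0).eigenspace t) (hx : x ∈ wordSpan L r k v) {s : ℤ}
    (hx' : x ∈ (L 0).eigenspace (t + s)) :
    x ∈ Submodule.span ℂ {y | ∃ l : List ℤ, (∀ n ∈ l, n ≤ -r) ∧ l.sum = -s ∧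
      applyWord L l v = y} := by
  set S := Submodule.span ℂ {y | ∃ l : List ℤ, (∀ n ∈ l, n ≤ -r) ∧ l.sum = -s ∧
      applyWord L l v = y} with hS
  have hSle : S ≤ (L 0).eigenspace (t + s) := by
    refine Submodule.span_le.2 ?_
    rintro _ ⟨l, -, h2, rfl⟩
    have := applyWord_mem_eigenspace hL hv l
    rwa [h2, Int.cast_neg, sub_neg_eq_add] at this
  have h1 : wordSpan L r k v ≤ S ⊔ ⨆ (u : ℂ) (_ : u ≠ t + s), (L 0).eigenspace u := by
    refine Submodule.span_le.2 ?_
    rintro _ ⟨l, h1, -, rfl⟩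
    by_cases h : l.sum = -s
    · exact Submodule.mem_sup_left (Submodule.subset_span ⟨l, h1, h, rfl⟩)
    · refine Submodule.mem_sup_right (Submodule.mem_iSup_of_mem (t - (l.sum : ℤ))
        (Submodule.mem_iSup_of_mem ?_ (applyWord_mem_eigenspace hL hv l)))
      intro h'
      apply h
      have : ((l.sum : ℤ) : ℂ) = ((-s : ℤ) : ℂ) := by
        rw [Int.cast_neg]; linear_combination -h'
      exact_mod_cast this
  obtain ⟨y, hy, z, hz, rfl⟩ := Submodule.mem_sup.1 (h1 hx)
  have hz' : z ∈ (L 0).eigenspace (t + s) := by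
    have := Submodule.sub_mem _ hx' (hSle hy)
    simpa using this
  have := (Module.End.eigenspaces_iSupIndep (L 0)) (t + s)
  have hz0 := (Submodule.disjoint_def.1 this) z hz' hz
  simpa [hz0] using hy

/-- Words applied to a vector of positive weight have nonzero weight. -/
theorem wordSpan_le_iSup_eigenspace {L : ℤ → Module.End ℂ V} {c : ℂ}
    (hL : VirasoroBracket L L c) {r : ℤ} (hr : 0 ≤ r) (k : ℕ) {s : ℕ} (hs : 0 < s) {v : V}
    (hv : v ∈ (L 0).eigenspace (s : ℂ)) :
    wordSpan L r k v ≤ ⨆ (u : ℂ) (_ : u ≠ 0), (L 0).eigenspace u := by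
  refine Submodule.span_le.2 ?_
  rintro _ ⟨l, h1, -, rfl⟩
  refine Submodule.mem_iSup_of_mem _ (Submodule.mem_iSup_of_mem ?_
    (applyWord_mem_eigenspace hL hv l))
  have h2 : l.sum ≤ 0 := by
    induction l with
    | nil => simp
    | cons n l ih =>
      have h3 := h1 n (by simp)
      have h4 := ih fun n hn => h1 n (by simp [hn])
      rw [List.sum_cons]
      omega
  have h3 : (s : ℤ) - l.sum ≠ 0 := by omega
  exact_mod_cast h3

/-- Bounds the length of a vacuum word: at most 1, 2, 3 letters in degrees 2, 4, 6. -/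
theorem sum_le_of_forall_le {l : List ℤ} (h : ∀ n ∈ l, n ≤ -2) : l.sum ≤ -2 * l.length := by
  induction l with
  | nil => simp
  | cons n l ih =>
    have h3 := h n (by simp)
    have h4 := ih fun n hn => h n (by simp [hn])
    rw [List.sum_cons, List.length_cons]
    push_cast
    omega

section Vacuum

variable {L : ℤ → Module.End ℂ V} {c : ℂ} {vac : V}

/-- Homogeneous elements of the vacuum module are spanned by words in the `L n`, `n ≤ -2`. -/
theorem mem_span_applyWord_vacuum (hL : VirasoroBracket L L c) (hv : ∀ n, -1 ≤ n → L n vac = 0)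
    {x : V} (hx : x ∈ sInf {U : Submodule ℂ V | vac ∈ U ∧ ∀ n : ℤ, ∀ w ∈ U, L n w ∈ U})
    {s : ℤ} (hx' : x ∈ (L 0).eigenspace (s : ℂ)) :
    x ∈ Submodule.span ℂ {y | ∃ l : List ℤ, (∀ n ∈ l, n ≤ -2) ∧ l.sum = -s ∧
      applyWord L l vac = y} := by
  obtain ⟨k, hk⟩ := exists_mem_wordSpan_of_mem hL (r := 2)
    (fun n hn => by rw [hv n (by omega)]; exact Submodule.zero_mem _) hx
  refine mem_span_applyWord_of_mem_eigenspace hL (t := 0) ?_ hk (by simpa using hx')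
  rw [Module.End.mem_eigenspace_iff, hv 0 (by omega), zero_smul]

theorem exists_eq_of_mem_vacuum_two (hL : VirasoroBracket L L c)
    (hv : ∀ n, -1 ≤ n → L n vac = 0) {x : V}
    (hx : x ∈ sInf {U : Submodule ℂ V | vac ∈ U ∧ ∀ n : ℤ, ∀ w ∈ U, L n w ∈ U})
    (hx' : x ∈ (L 0).eigenspace ((2 : ℕ) : ℂ)) : ∃ a : ℂ, x = a • L (-2) vac := by
  have h := mem_span_applyWord_vacuum hL hv hx (s := 2) (by simpa using hx')
  have h2 : x ∈ Submodule.span ℂ {L (-2) vac} := by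
    refine Submodule.span_le.2 ?_ h
    rintro _ ⟨l, h1, h2, rfl⟩
    have h3 := sum_le_of_forall_le h1
    match l with
    | [] => simp at h2
    | [a] =>
      obtain rfl : a = -2 := by simpa using h2
      exact Submodule.mem_span_singleton_self _
    | a :: b :: l => simp at h3; simp at h2; omega
  obtain ⟨a, rfl⟩ := Submodule.mem_span_singleton.1 h2
  exact ⟨a, rfl⟩

theorem exists_eq_of_mem_vacuum_four (hL : VirasoroBracket L L c)
    (hv : ∀ n, -1 ≤ n → L n vac = 0) {x : V}
    (hx : x ∈ sInf {U : Submodule ℂ V | vac ∈ U ∧ ∀ n : ℤ, ∀ w ∈ U, L n w ∈ U})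
    (hx' : x ∈ (L 0).eigenspace ((4 : ℕ) : ℂ)) :
    ∃ a b : ℂ, x = a • L (-4) vac + b • L (-2) (L (-2) vac) := by
  have h := mem_span_applyWord_vacuum hL hv hx (s := 4) (by simpa using hx')
  have h2 : x ∈ Submodule.span ℂ {L (-4) vac, L (-2) (L (-2) vac)} := by
    refine Submodule.span_le.2 ?_ h
    rintro _ ⟨l, h1, h2, rfl⟩
    have h3 := sum_le_of_forall_le h1
    match l with
    | [] => simp at h2
    | [a] =>
      obtain rfl : a = -4 := by simpa using h2
      exact Submodule.subset_span (by simp [applyWord])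
    | [a, b] =>
      simp at h1 h2
      obtain rfl : a = -2 := by omega
      obtain rfl : b = -2 := by omega
      exact Submodule.subset_span (by simp [applyWord])
    | a :: b :: c :: l => simp at h3; simp at h2; omega
  obtain ⟨a, b, rfl⟩ := Submodule.mem_span_pair.1 h2
  exact ⟨a, b, rfl⟩

theorem exists_eq_of_mem_vacuum_six (hL : VirasoroBracket L L c)
    (hv : ∀ n, -1 ≤ n → L n vac = 0) {x : V}
    (hx : x ∈ sInf {U : Submodule ℂ V | vac ∈ U ∧ ∀ n : ℤ, ∀ w ∈ U, L n w ∈ U})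
    (hx' : x ∈ (L 0).eigenspace ((6 : ℕ) : ℂ)) :
    ∃ a₁ a₂ a₃ a₄ : ℂ, x = a₁ • L (-6) vac + (a₂ • L (-4) (L (-2) vac) +
      (a₃ • L (-3) (L (-3) vac) + a₄ • L (-2) (L (-2) (L (-2) vac)))) := by
  have h := mem_span_applyWord_vacuum hL hv hx (s := 6) (by simpa using hx')
  have h2 : x ∈ Submodule.span ℂ {L (-6) vac, L (-4) (L (-2) vac), L (-3) (L (-3) vac),
      L (-2) (L (-2) (L (-2) vac))} := by
    refine Submodule.span_le.2 ?_ h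
    rintro _ ⟨l, h1, h2, rfl⟩
    have h3 := sum_le_of_forall_le h1
    match l with
    | [] => simp at h2
    | [a] =>
      obtain rfl : a = -6 := by simpa using h2
      exact Submodule.subset_span (by simp [applyWord])
    | [a, b] =>
      simp at h1 h2
      obtain rfl : b = -6 - a := by omega
      obtain rfl | rfl | rfl : a = -2 ∨ a = -3 ∨ a = -4 := by omega
      -- The only unordered word in these degrees; [L₋₂, L₋₄] = 2L₋₆ orders it.
      · have h4 : applyWord L [-2, -6 - -2] vac = L (-4) (L (-2) vac) + (2 : ℂ) • L (-6) vac := by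
          simp [applyWord, hL (-2) (-4)]
          norm_num
        rw [h4]
        exact Submodule.add_mem _ (Submodule.subset_span (by simp))
          (Submodule.smul_mem _ _ (Submodule.subset_span (by simp)))
      · exact Submodule.subset_span (by simp [applyWord])
      · exact Submodule.subset_span (by simp [applyWord])
    | [a, b, d] =>
      simp at h1 h2
      obtain rfl : a = -2 := by omega
      obtain rfl : b = -2 := by omega
      obtain rfl : d = -2 := by omega
      exact Submodule.subset_span (by simp [applyWord])
    | a :: b :: c :: d :: l => simp at h3; simp at h2; omega
  simp only [Submodule.mem_span_insert, Submodule.mem_span_singleton] at h2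
  obtain ⟨a₁, _, ⟨a₂, _, ⟨a₃, _, ⟨a₄, rfl⟩, rfl⟩, rfl⟩, rfl⟩ := h2
  exact ⟨a₁, a₂, a₃, a₄, rfl⟩

end Vacuum

end VirasoroWords

/-! ### Gram matrices of the vacuum module and pairings with ω'-descendants -/

section VirasoroComputations

variable {V : Type*} [AddCommGroup V] [Module ℂ V]
  {L P : ℤ → Module.End ℂ V} {c e : ℂ} {vac : V}

theorem pairing_two (hLP : VirasoroBracket L P e) (hv : ∀ n, -1 ≤ n → L n vac = 0)
    (hv' : ∀ n, -1 ≤ n → P n vac = 0) : L 2 (P (-2) vac) = (1 / 2 * e) • vac := by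
  simp [hLP 2 (-2), hv, hv']
  module

theorem gram_four (hL : VirasoroBracket L L c) (hv : ∀ n, -1 ≤ n → L n vac = 0) :
    L 4 (L (-4) vac) = (5 * c) • vac ∧
    L 4 (L (-2) (L (-2) vac)) = (3 * c) • vac ∧
    L 2 (L 2 (L (-4) vac)) = (3 * c) • vac ∧
    L 2 (L 2 (L (-2) (L (-2) vac))) = (4 * c + 1/2 * c ^ 2) • vac := by
  refine ⟨?_, ?_, ?_, ?_⟩ <;>
  · simp [hL 4 (-4), hL 4 (-2), hL 2 (-4), hL 2 (-2), hL 0 (-2), hv]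
    try module

/-- The raising words are the adjoints of the four spanning words, so these sixteen values form a
symmetric matrix, listed row by row. -/
theorem gram_six (hL : VirasoroBracket L L c) (hv : ∀ n, -1 ≤ n → L n vac = 0) :
    L 6 (L (-6) vac) = (35/2 * c) • vac ∧
    L 6 (L (-4) (L (-2) vac)) = (5 * c) • vac ∧
    L 6 (L (-3) (L (-3) vac)) = (18 * c) • vac ∧
    L 6 (L (-2) (L (-2) (L (-2) vac))) = (24 * c) • vac ∧
    L 2 (L 4 (L (-6) vac)) = (5 * c) • vac ∧
    L 2 (L 4 (L (-4) (L (-2) vac))) = (8 * c + 5/2 * c ^ 2) • vac ∧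
    L 2 (L 4 (L (-3) (L (-3) vac))) = (14 * c) • vac ∧
    L 2 (L 4 (L (-2) (L (-2) (L (-2) vac)))) = (24 * c + 9/2 * c ^ 2) • vac ∧
    L 3 (L 3 (L (-6) vac)) = (18 * c) • vac ∧
    L 3 (L 3 (L (-4) (L (-2) vac))) = (14 * c) • vac ∧
    L 3 (L 3 (L (-3) (L (-3) vac))) = (36 * c + 8 * c ^ 2) • vac ∧
    L 3 (L 3 (L (-2) (L (-2) (L (-2) vac)))) = (30 * c) • vac ∧
    L 2 (L 2 (L 2 (L (-6) vac))) = (24 * c) • vac ∧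
    L 2 (L 2 (L 2 (L (-4) (L (-2) vac)))) = (24 * c + 9/2 * c ^ 2) • vac ∧
    L 2 (L 2 (L 2 (L (-3) (L (-3) vac)))) = (30 * c) • vac ∧
    L 2 (L 2 (L 2 (L (-2) (L (-2) (L (-2) vac))))) = (96 * c + 18 * c ^ 2 + 3/4 * c ^ 3) • vac := by
  refine ⟨?_, ?_, ?_, ?_, ?_, ?_, ?_, ?_, ?_, ?_, ?_, ?_, ?_, ?_, ?_, ?_⟩ <;>
  · simp [hL 6 (-6), hL 6 (-4), hL 6 (-3), hL 6 (-2), hL 4 (-6), hL 4 (-4), hL 4 (-3), hL 4 (-2),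
      hL 3 (-6), hL 3 (-4), hL 3 (-3), hL 3 (-2), hL 2 (-6), hL 2 (-4), hL 2 (-3), hL 2 (-2),
      hL 1 (-3), hL 1 (-2), hL 0 (-3), hL 0 (-2), hL (-1) (-3), hL (-1) (-2), hv]
    try module

theorem pairing_four (hLP : VirasoroBracket L P e) (hP : VirasoroBracket P P e)
    (hv : ∀ n, -1 ≤ n → L n vac = 0) (hv' : ∀ n, -1 ≤ n → P n vac = 0) :
    L 4 (P (-2) (P (-2) vac)) = (3 * e) • vac ∧
    L 2 (L 2 (P (-2) (P (-2) vac))) = (4 * e + 1/2 * e ^ 2) • vac := by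
  refine ⟨?_, ?_⟩ <;>
  · simp [hLP 4 (-2), hLP 2 (-2), hP 2 (-2), hP 0 (-2), hv, hv']
    try module

/-- Only the first commutation is mixed; it turns `L` into `P`, so the answers involve `e` and not
the central charge of `L`. -/
theorem pairing_six (hLP : VirasoroBracket L P e) (hP : VirasoroBracket P P e)
    (hv : ∀ n, -1 ≤ n → L n vac = 0) (hv' : ∀ n, -1 ≤ n → P n vac = 0) :
    L 6 (P (-3) (P (-3) vac)) = (18 * e) • vac ∧
    L 2 (L 4 (P (-3) (P (-3) vac))) = (14 * e) • vac ∧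
    L 3 (L 3 (P (-3) (P (-3) vac))) = (36 * e + 8 * e ^ 2) • vac ∧
    L 2 (L 2 (L 2 (P (-3) (P (-3) vac)))) = (30 * e) • vac := by
  refine ⟨?_, ?_, ?_, ?_⟩ <;>
  · simp [hLP 6 (-3), hLP 4 (-3), hLP 3 (-3), hLP 2 (-4), hLP 2 (-3), hLP 2 (-2), hP 3 (-3),
      hP 1 (-3), hP 0 (-3), hP (-1) (-3), hv, hv']
    try module

end VirasoroComputations

/-! ### The mixed bracket and the projection π -/

namespace VOA

variable {V : Type*} [AddCommGroup V] [Module ℂ V] (A : VOA V)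

/-- The modes `x₍ₙ₊₁₎`, numbered like Virasoro operators. -/
def shiftedMode (x : V) (n : ℤ) : Module.End ℂ V := A.mode x (n + 1)

theorem shiftedMode_vac (x : V) {n : ℤ} (hn : -1 ≤ n) : A.shiftedMode x n A.vac = 0 :=
  A.creation_nonneg x _ (by omega)

theorem shiftedMode_neg_two_vac (x : V) : A.shiftedMode x (-2) A.vac = x := A.creation x

theorem bracket_conf :
    VirasoroBracket (A.shiftedMode A.conf) (A.shiftedMode A.conf) A.c :=
  VirasoroRelations.bracket A.virasoro

variable {A}

theorem IsVirasoroElement.bracket {x : V} {e : ℂ} (h : A.IsVirasoroElement x e) :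
    VirasoroBracket (A.shiftedMode x) (A.shiftedMode x) e :=
  VirasoroRelations.bracket h

theorem mem_generatedBy_singleton (x : V) : x ∈ A.generatedBy {x} :=
  Submodule.mem_sInf.2 fun _ hU => hU.2.1 rfl

/-- The modes of ω - x commute with those of x, so inside a commutator with a mode of x one may
replace ω by x. -/
theorem bracket_conf_of_commuting {x : V} {e : ℂ} (h : A.IsVirasoroElement x e)
    (hcomm : A.Commuting (A.generatedBy {x}) (A.generatedBy {A.conf - x})) :
    VirasoroBracket (A.shiftedMode A.conf) (A.shiftedMode x) e := by
  intro m n v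
  have h1 := hcomm x (mem_generatedBy_singleton x) _ (mem_generatedBy_singleton (A.conf - x))
    (n + 1) (m + 1)
  have h2 := congrArg (fun f => f v) h1.eq
  have h3 := h.bracket m n v
  have h4 : A.mode (A.conf - x) (m + 1) = A.mode A.conf (m + 1) - A.mode x (m + 1) := by
    simp [mode]
  rw [h4] at h2
  simp only [Module.End.mul_apply, LinearMap.sub_apply, map_sub] at h2
  simp only [shiftedMode] at h3 ⊢
  have h5 : A.mode A.conf (m + 1) (A.mode x (n + 1) v) = A.mode x (n + 1) (A.mode A.conf (m + 1) v) -
      A.mode x (n + 1) (A.mode x (m + 1) v) + A.mode x (m + 1) (A.mode x (n + 1) v) := by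
    rw [h2]
    abel
  rw [h5, h3]
  abel

namespace HighestWeightDecomposition

variable {ι : Type*} (D : A.HighestWeightDecomposition ι)

/-- A highest weight vector of weight 0 lies in V₀ = ℂ1. -/
theorem component_zero_le : D.component 0 ≤ A.virasoroSpan A.vac := by
  refine iSup₂_le fun i hi => ?_
  have hw : D.weight i = 0 := hi
  have h0 : D.hwVector i ∈ Submodule.span ℂ {A.vac} := by
    rw [← A.degree_zero, Module.End.mem_eigenspace_iff]
    have := D.L_zero_hwVector i
    rwa [hw, Nat.cast_zero] at this
  obtain ⟨a, ha⟩ := Submodule.mem_span_singleton.1 h0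
  refine sInf_le ⟨?_, fun n w hw => L_mem_virasoroSpan n hw⟩
  rw [← ha]
  exact Submodule.smul_mem _ _ (Submodule.mem_sInf.2 fun U hU => hU.1)

/-- Lowering operators only increase the weight, so a highest weight module of positive weight has
nothing in degree 0. -/
theorem eq_zero_of_mem_positivePart {x : V} (hx : x ∈ D.positivePart)
    (hx' : x ∈ A.degreePart 0) : x = 0 := by
  have hle : D.positivePart ≤ ⨆ (u : ℂ) (_ : u ≠ 0), (A.L 0).eigenspace u := by
    rw [positivePart_eq]
    refine iSup₂_le fun i hi y hy => ?_
    obtain ⟨k, hk⟩ := exists_mem_wordSpan_of_mem A.bracket_conf (r := 1) (v := D.hwVector i)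
      (fun n hn => by
        rcases (show n = 0 ∨ 0 < n by omega) with rfl | h
        · exact Submodule.mem_span_singleton.2 ⟨_, (D.L_zero_hwVector i).symm⟩
        · rw [show A.shiftedMode A.conf n (D.hwVector i) = 0 from D.L_pos_hwVector i n h]
          exact Submodule.zero_mem _) hy
    exact wordSpan_le_iSup_eigenspace A.bracket_conf zero_le_one k (s := D.weight i) hi
      (Module.End.mem_eigenspace_iff.2 (D.L_zero_hwVector i)) hk
  have := Module.End.eigenspaces_iSupIndep (A.L 0) 0
  refine (Submodule.disjoint_def.1 this) x ?_ (hle hx)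
  simpa [degreePart] using hx'

theorem proj_mem (v : V) : D.proj v ∈ A.virasoroSpan A.vac :=
  D.component_zero_le (Submodule.projection_apply_mem D.isCompl v)

theorem sub_proj_mem (v : V) : v - D.proj v ∈ D.positivePart := by
  rw [← Submodule.projection_apply_eq_zero_iff D.isCompl, map_sub, sub_eq_zero]
  exact ((Submodule.projection_eq_self_iff D.isCompl _).2
    (Submodule.projection_apply_mem D.isCompl v)).symm

/-- Words of degree `-n` in the Virasoro operators do not distinguish `v ∈ V_n` from `π(v)`. -/
theorem applyWord_proj {n : ℕ} {v : V} (hv : v ∈ A.degreePart n) {l : List ℤ} (hl : l.sum = n) :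
    applyWord (A.shiftedMode A.conf) l (D.proj v) = applyWord (A.shiftedMode A.conf) l v := by
  have hsub : ∀ (l : List ℤ) (x y : V), applyWord (A.shiftedMode A.conf) l (x - y) =
      applyWord (A.shiftedMode A.conf) l x - applyWord (A.shiftedMode A.conf) l y := by
    intro l x y
    induction l with
    | nil => rfl
    | cons n l ih => rw [applyWord_cons, ih, map_sub]; rfl
  have hpos : ∀ l : List ℤ, applyWord (A.shiftedMode A.conf) l (v - D.proj v) ∈ D.positivePart := by
    intro l
    induction l with
    | nil => exact D.sub_proj_mem v
    | cons n l ih => exact D.L_mem_positivePart n ih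
  have hdeg : applyWord (A.shiftedMode A.conf) l (v - D.proj v) ∈ A.degreePart 0 := by
    have := applyWord_mem_eigenspace A.bracket_conf
      (Submodule.sub_mem _ hv (D.proj_mem_degreePart hv)) l
    rw [hl, Int.cast_natCast, sub_self] at this
    rw [degreePart, Nat.cast_zero]
    exact this
  have := D.eq_zero_of_mem_positivePart (hpos l) hdeg
  rw [hsub, sub_eq_zero] at this
  exact this.symm

end HighestWeightDecomposition
end VOA

/-! ### Zero modes on the lowest degree part -/

namespace VOAModule

variable {V : Type*} [AddCommGroup V] [Module ℂ V] {A : VOA V}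
  {W : Type*} [AddCommGroup W] [Module ℂ W] (M : VOAModule A W)

theorem mode_mem_degreePart_shift {n : ℕ} {v : V} (hv : v ∈ A.degreePart n) (k : ℤ) {l : ℂ}
    {w : W} (hw : w ∈ M.degreePart l) : M.mode v k w ∈ M.degreePart (l + n - k - 1) := by
  rw [degreePart, Module.End.mem_eigenspace_iff] at hw ⊢
  have hv' : A.mode A.conf 1 v = (n : ℂ) • v := by
    rw [VOA.degreePart, Module.End.mem_eigenspace_iff] at hv
    simpa [VOA.L] using hv
  -- With `m = 1`, `n = 0` this is the commutator formula for L₀ and v₍ₖ₎.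
  have hB := M.borcherds A.conf v w 1 0 k
  rw [finsum_eq_sum_of_support_subset (s := Finset.range 2) _ (by
      intro i hi
      by_contra hi'
      apply hi
      have : 1 < i := by simpa using hi'
      change Ring.choose (1 : ℤ) i • _ = _
      rw [show (1 : ℤ) = ((1 : ℕ) : ℤ) by simp, Ring.choose_natCast, Nat.choose_eq_zero_of_lt this]
      simp),
    finsum_eq_single _ 0 (by
      intro i hi
      rw [Ring.choose_zero_pos ℤ (Nat.pos_of_ne_zero hi), mul_zero, zero_smul])] at hB
  have h0 := M.translation_mode v (k + 1) w
  simp only [mode, VOA.mode] at h0 hv' hw ⊢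
  rw [add_comm k 1] at h0
  simp [Finset.sum_range_succ, hv', hw, h0] at hB
  rw [eq_comm, sub_eq_iff_eq_add] at hB
  rw [hB]
  module

theorem degreePart_eq_bot {h : ℂ} (hM : M.HasConformalWeight h) {l : ℂ}
    (hl : ∀ n : ℕ, l ≠ h + n) : M.degreePart l = ⊥ := by
  have h1 := Module.End.eigenspaces_iSupIndep (M.mode A.conf 1) l
  rw [← disjoint_self]
  refine h1.mono_right ((le_top.trans hM.1.ge).trans (iSup_le fun n => ?_))
  exact le_iSup₂_of_le (h + n) (hl n).symm le_rfl

/-- Such a mode lowers the weight by k - n + 1 ≥ 1, and nothing lies below `W_h`. -/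
theorem mode_eq_zero {h : ℂ} (hM : M.HasConformalWeight h) {n : ℕ} {v : V}
    (hv : v ∈ A.degreePart n) {k : ℤ} (hk : (n : ℤ) ≤ k) {w : W} (hw : w ∈ M.degreePart h) :
    M.mode v k w = 0 := by
  have := M.mode_mem_degreePart_shift hv k hw
  rwa [M.degreePart_eq_bot hM, Submodule.mem_bot] at this
  intro j hj
  have : ((n : ℤ) - k - 1 : ℂ) = ((j : ℤ) : ℂ) := by push_cast; linear_combination hj
  have : (n : ℤ) - k - 1 = (j : ℤ) := by exact_mod_cast this
  omega

theorem mode_zero_commute (u v : V) (k : ℤ) (w : W) :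
    M.mode (A.mode u 0 v) k w = M.mode u 0 (M.mode v k w) - M.mode v k (M.mode u 0 w) := by
  have hB := M.borcherds u v w 0 0 k
  rw [finsum_eq_single _ 0 (by
      intro i hi
      rw [Ring.choose_zero_pos ℤ (Nat.pos_of_ne_zero hi), zero_smul]),
    finsum_eq_single _ 0 (by
      intro i hi
      rw [Ring.choose_zero_pos ℤ (Nat.pos_of_ne_zero hi), mul_zero, zero_smul])] at hB
  simpa using hB

/-- The zero mode of `x₍₁₋ₙ₎ v`, for `x` of degree `2`, on the lowest degree part. -/
theorem zeroMode_shiftedMode {h : ℂ} (hM : M.HasConformalWeight h) {x v : V} {d : ℕ}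
    (hx : x ∈ A.degreePart 2) (hv : v ∈ A.degreePart d) (N : ℕ) (hN : 1 ≤ N)
    {w : W} (hw : w ∈ M.degreePart h) :
    M.mode (A.shiftedMode x (-N) v) ((d : ℤ) + N - 1) w =
      ((-1) ^ N : ℂ) • (((N : ℂ) - 1) • M.mode v ((d : ℤ) - 1) (M.mode x 1 w) -
        M.mode (A.mode x 0 v) d w) := by
  -- Associativity (`m = 0`). In the first half of the sum v acts first and kills `w`; in the second
  -- x₍ᵢ₎ kills `w` for i ≥ 2. Only i = 0, 1 of the second half remain.
  have hB := M.borcherds x v w 0 (-N + 1) (d + N - 1)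
  rw [finsum_eq_single _ 0 (by
      intro i hi
      rw [Ring.choose_zero_pos ℤ (Nat.pos_of_ne_zero hi), zero_smul]),
    finsum_eq_sum_of_support_subset (s := Finset.range 2) _ (by
      intro i hi
      by_contra hi'
      apply hi
      have h1 : 1 < i := by simpa using hi'
      have h2 := M.mode_eq_zero hM hx (k := 0 + i) (by push_cast; omega) hw
      have h3 := M.mode_eq_zero hM hv (k := (d : ℤ) + N - 1 + i) (by omega) hw
      simp only [mode] at h2 h3
      simp only [h2, h3, map_zero, smul_zero, sub_zero])] at hB
  have h0 := M.mode_eq_zero hM hv (k := (d : ℤ) + N - 1) (by omega) hw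
  have h1 := M.mode_eq_zero hM hv (k := (d : ℤ) + N) (by omega) hw
  -- Rewrites the i = 0 term: since v₍d₎w = 0, v₍d₎x₍₀₎w = -(x₍₀₎v)₍d₎w.
  have h2 := M.mode_zero_commute x v d w
  rw [M.mode_eq_zero hM hv le_rfl hw, map_zero, zero_sub] at h2
  have h3 : (((-N + 1 : ℤ).negOnePow : ℤˣ) : ℤ) = -(-1) ^ N := by
    rw [Int.negOnePow_succ, Int.negOnePow_neg, Units.val_neg, Int.coe_negOnePow_natCast]
  have e1 : (-N + 1 + (d + N - 1) : ℤ) = d := by ring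
  simp only [mode, VOA.mode] at h0 h1 h2
  simp only [mode, VOA.mode, VOA.shiftedMode]
  simp [Finset.sum_range_succ, h0, h1, h3, e1] at hB
  rw [hB, h2]
  simp [← Int.cast_smul_eq_zsmul ℂ]
  module

/-- The zero mode of `L₋ₙ v` on the lowest degree part. -/
theorem zeroMode_conf {h : ℂ} (hM : M.HasConformalWeight h) (hω : A.conf ∈ A.degreePart 2)
    {v : V} {d : ℕ} (hv : v ∈ A.degreePart d) (N : ℕ) (hN : 1 ≤ N)
    {w : W} (hw : w ∈ M.degreePart h) :
    M.mode (A.shiftedMode A.conf (-N) v) ((d : ℤ) + N - 1) w =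
      ((-1) ^ N * ((N - 1) * h + d) : ℂ) • M.mode v ((d : ℤ) - 1) w := by
  rw [M.zeroMode_shiftedMode hM hω hv N hN hw, M.translation_mode,
    Module.End.mem_eigenspace_iff.1 hw, map_smul]
  push_cast
  module

theorem traceO_eq {l : ℂ} {n : ℕ} {v : V} (hv : v ∈ A.degreePart n)
    (T : Module.End ℂ (M.degreePart l))
    (hT : ∀ w : M.degreePart l, M.mode v ((n : ℤ) - 1) w = T w) :
    M.traceO l hv = LinearMap.trace ℂ _ T := by
  rw [traceO]
  congr 1
  ext w
  exact hT w

end VOAModule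

/-! ### Elimination of the traces and of the projection coefficients -/

/-- Here `m₁` = tr T, `m₂` = tr T² and `d` = dim W_h; the remaining unknowns are the coefficients of
the three projections. -/
theorem quadratic_relation {c e h d m₁ m₂ a α β a₁ a₂ a₃ a₄ : ℂ}
    (h2 : a * (1 / 2 * c) = 1 / 2 * e)
    (h4 : α * (5 * c) + β * (3 * c) = 3 * e)
    (h4' : α * (3 * c) + β * (4 * c + 1 / 2 * c ^ 2) = 4 * e + 1 / 2 * e ^ 2)
    (h6 : a₁ * (35 / 2 * c) + (a₂ * (5 * c) + (a₃ * (18 * c) + a₄ * (24 * c))) = 18 * e)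
    (h6' : a₁ * (5 * c) + (a₂ * (8 * c + 5 / 2 * c ^ 2) + (a₃ * (14 * c) +
      a₄ * (24 * c + 9 / 2 * c ^ 2))) = 14 * e)
    (h6'' : a₁ * (18 * c) + (a₂ * (14 * c) + (a₃ * (36 * c + 8 * c ^ 2) + a₄ * (30 * c))) =
      36 * e + 8 * e ^ 2)
    (h6''' : a₁ * (24 * c) + (a₂ * (24 * c + 9 / 2 * c ^ 2) + (a₃ * (30 * c) +
      a₄ * (96 * c + 18 * c ^ 2 + 3 / 4 * c ^ 3))) = 30 * e)
    (ht2 : m₁ = a * h * d)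
    (ht4 : m₂ + 2 * m₁ = (α * (3 * h) + β * ((h + 2) * h)) * d)
    (ht6 : 4 * m₂ + 6 * m₁ = (a₁ * (5 * h) + (a₂ * ((3 * h + 2) * h) +
      (a₃ * ((4 * h + 6) * h) + a₄ * ((h + 4) * ((h + 2) * h))))) * d) :
    4 * h * e * (c - e) * d * (4 + 7 * c + c ^ 2 - 124 * h - 31 * c * h + 248 * h ^ 2) = 0 := by
  -- The combination `ht6 - 4 * ht4 + 2 * ht2` cancels `m₁` and `m₂`. Its prefactor clears the
  -- denominators of the inverse Gram matrices in degrees 2, 4, 6; the other multipliers are those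
  -- inverses applied to the zero-mode scalars.
  linear_combination (c * (2 * c - 1) * (5 * c + 22) * (7 * c + 68)) *
      (ht6 - 4 * ht4 + 2 * ht2) +
    d * h * (-368 + 592 * c + 260 * c ^ 2 + 20 * c ^ 3 + h * (392 - 592 * c - 60 * c ^ 2) +
      h ^ 2 * (-104 - 80 * c)) * h6 +
    d * h * (-80 + 130 * c + 16 * c ^ 2 + h * (-172 + 698 * c + 84 * c ^ 2) +
      h ^ 2 * (-268 - 168 * c)) * h6' +
    d * h * (-32 + 68 * c + 15 / 2 * c ^ 2 + h * (-232 + 307 * c + 35 * c ^ 2) +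
      h ^ 2 * 124) * h6'' +
    d * h * (-8 / 3 + 32 / 3 * c + h * (-76 + 56 * c) + h ^ 2 * (116 / 3 + 280 / 3 * c)) * h6''' -
    8 * d * h * (2 * c - 1) * (7 * c + 68) * (3 * (c + 8) / 2 - 3 * (h + 2)) * h4 -
    8 * d * h * (2 * c - 1) * (7 * c + 68) * (5 * (h + 2) - 9) * h4' +
    4 * d * h * (2 * c - 1) * (5 * c + 22) * (7 * c + 68) * h2

/-! ### Linear equations for the coefficients of π -/

namespace VOA

variable {V : Type*} [AddCommGroup V] [Module ℂ V] (A : VOA V)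

theorem vac_mem_degreePart : A.vac ∈ A.degreePart 0 := by
  rw [degreePart, Module.End.mem_eigenspace_iff, Nat.cast_zero, zero_smul]
  exact A.shiftedMode_vac A.conf (by omega)

variable {A}

theorem shiftedMode_mem_degreePart {x : V} {e : ℂ}
    (hx : VirasoroBracket (A.shiftedMode A.conf) (A.shiftedMode x) e) {v : V} {d d' : ℕ}
    (hv : v ∈ A.degreePart d) {n : ℤ} (hn : (d' : ℤ) = d - n) :
    A.shiftedMode x n v ∈ A.degreePart d' := by
  have h := hx.apply_mem_eigenspace hv n
  have h' : (d' : ℂ) = d - n := by exact_mod_cast hn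
  rw [← h'] at h
  exact h

namespace HighestWeightDecomposition

variable {ι : Type*} (D : A.HighestWeightDecomposition ι) {x : V} {e : ℂ}

theorem exists_proj_two (hLP : VirasoroBracket (A.shiftedMode A.conf) (A.shiftedMode x) e)
    (hx : x ∈ A.degreePart 2) :
    ∃ a : ℂ, D.proj x = a • A.shiftedMode A.conf (-2) A.vac ∧
      a * (1 / 2 * A.c) = 1 / 2 * e := by
  have hv := fun n hn => A.shiftedMode_vac A.conf (n := n) hn
  have hv' := fun n hn => A.shiftedMode_vac x (n := n) hn
  obtain ⟨a, ha⟩ := exists_eq_of_mem_vacuum_two A.bracket_conf hv (D.proj_mem x)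
    (D.proj_mem_degreePart hx)
  have h := D.applyWord_proj hx (l := [2]) (by simp)
  rw [ha] at h
  simp only [applyWord, List.foldr, map_smul] at h
  rw [pairing_two A.bracket_conf hv hv] at h
  have h' := pairing_two hLP hv hv'
  rw [A.shiftedMode_neg_two_vac] at h'
  rw [h', smul_smul] at h
  exact ⟨a, ha, smul_left_injective ℂ A.vac_ne_zero h⟩

theorem exists_proj_four (hLP : VirasoroBracket (A.shiftedMode A.conf) (A.shiftedMode x) e)
    (hP : VirasoroBracket (A.shiftedMode x) (A.shiftedMode x) e)
    (hx : A.shiftedMode x (-2) (A.shiftedMode x (-2) A.vac) ∈ A.degreePart 4) :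
    ∃ α β : ℂ, D.proj (A.shiftedMode x (-2) (A.shiftedMode x (-2) A.vac)) =
        α • A.shiftedMode A.conf (-4) A.vac +
          β • A.shiftedMode A.conf (-2) (A.shiftedMode A.conf (-2) A.vac) ∧
      α * (5 * A.c) + β * (3 * A.c) = 3 * e ∧
      α * (3 * A.c) + β * (4 * A.c + 1 / 2 * A.c ^ 2) = 4 * e + 1 / 2 * e ^ 2 := by
  have hv := fun n hn => A.shiftedMode_vac A.conf (n := n) hn
  have hv' := fun n hn => A.shiftedMode_vac x (n := n) hn
  obtain ⟨α, β, hαβ⟩ := exists_eq_of_mem_vacuum_four A.bracket_conf hv (D.proj_mem _)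
    (D.proj_mem_degreePart hx)
  have h := D.applyWord_proj hx (l := [4]) (by simp)
  have h' := D.applyWord_proj hx (l := [2, 2]) (by simp)
  obtain ⟨g₁, g₂, g₃, g₄⟩ := gram_four A.bracket_conf hv
  obtain ⟨p₁, p₂⟩ := pairing_four hLP hP hv hv'
  rw [hαβ] at h h'
  simp only [applyWord, List.foldr, map_smul, map_add, g₁, g₂, g₃, g₄, p₁, p₂, smul_smul,
    ← add_smul] at h h'
  exact ⟨α, β, hαβ, smul_left_injective ℂ A.vac_ne_zero h,
    smul_left_injective ℂ A.vac_ne_zero h'⟩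

/-- Apply L₆, L₂L₄, L₃², L₂³ to the vector and to its projection; the results agree and are
multiples of the vacuum. The coefficients need not be unique. -/
theorem exists_proj_six (hLP : VirasoroBracket (A.shiftedMode A.conf) (A.shiftedMode x) e)
    (hP : VirasoroBracket (A.shiftedMode x) (A.shiftedMode x) e)
    (hx : A.shiftedMode x (-3) (A.shiftedMode x (-3) A.vac) ∈ A.degreePart 6) :
    ∃ a₁ a₂ a₃ a₄ : ℂ, D.proj (A.shiftedMode x (-3) (A.shiftedMode x (-3) A.vac)) =
        a₁ • A.shiftedMode A.conf (-6) A.vac +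
        (a₂ • A.shiftedMode A.conf (-4) (A.shiftedMode A.conf (-2) A.vac) +
        (a₃ • A.shiftedMode A.conf (-3) (A.shiftedMode A.conf (-3) A.vac) +
        a₄ • A.shiftedMode A.conf (-2)
          (A.shiftedMode A.conf (-2) (A.shiftedMode A.conf (-2) A.vac)))) ∧
      a₁ * (35 / 2 * A.c) + (a₂ * (5 * A.c) + (a₃ * (18 * A.c) + a₄ * (24 * A.c))) = 18 * e ∧
      a₁ * (5 * A.c) + (a₂ * (8 * A.c + 5 / 2 * A.c ^ 2) + (a₃ * (14 * A.c) +
        a₄ * (24 * A.c + 9 / 2 * A.c ^ 2))) = 14 * e ∧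
      a₁ * (18 * A.c) + (a₂ * (14 * A.c) + (a₃ * (36 * A.c + 8 * A.c ^ 2) +
        a₄ * (30 * A.c))) = 36 * e + 8 * e ^ 2 ∧
      a₁ * (24 * A.c) + (a₂ * (24 * A.c + 9 / 2 * A.c ^ 2) + (a₃ * (30 * A.c) +
        a₄ * (96 * A.c + 18 * A.c ^ 2 + 3 / 4 * A.c ^ 3))) = 30 * e := by
  have hv := fun n hn => A.shiftedMode_vac A.conf (n := n) hn
  have hv' := fun n hn => A.shiftedMode_vac x (n := n) hn
  obtain ⟨a₁, a₂, a₃, a₄, ha⟩ := exists_eq_of_mem_vacuum_six A.bracket_conf hv (D.proj_mem _)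
    (D.proj_mem_degreePart hx)
  have h₁ := D.applyWord_proj hx (l := [6]) (by simp)
  have h₂ := D.applyWord_proj hx (l := [2, 4]) (by simp)
  have h₃ := D.applyWord_proj hx (l := [3, 3]) (by simp)
  have h₄ := D.applyWord_proj hx (l := [2, 2, 2]) (by simp)
  obtain ⟨g₁, g₂, g₃, g₄, g₅, g₆, g₇, g₈, g₉, g₁₀, g₁₁, g₁₂, g₁₃, g₁₄, g₁₅, g₁₆⟩ :=
    gram_six A.bracket_conf hv
  obtain ⟨p₁, p₂, p₃, p₄⟩ := pairing_six hLP hP hv hv'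
  rw [ha] at h₁ h₂ h₃ h₄
  simp only [applyWord, List.foldr, map_smul, map_add, g₁, g₂, g₃, g₄, g₅, g₆, g₇, g₈, g₉, g₁₀,
    g₁₁, g₁₂, g₁₃, g₁₄, g₁₅, g₁₆, p₁, p₂, p₃, p₄, smul_smul, ← add_smul] at h₁ h₂ h₃ h₄
  exact ⟨a₁, a₂, a₃, a₄, ha, smul_left_injective ℂ A.vac_ne_zero h₁,
    smul_left_injective ℂ A.vac_ne_zero h₂, smul_left_injective ℂ A.vac_ne_zero h₃,
    smul_left_injective ℂ A.vac_ne_zero h₄⟩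

end HighestWeightDecomposition
end VOA

/-! ### Scalar zero modes of descendants, and the zero modes built from ω' -/

namespace VOAModule

variable {V : Type*} [AddCommGroup V] [Module ℂ V] {A : VOA V}
  {W : Type*} [AddCommGroup W] [Module ℂ W] (M : VOAModule A W)

/-- `v ∈ V_d` and its zero mode acts on `W_h` as the scalar `s`. -/
def ActsAsScalar (h : ℂ) (v : V) (d : ℕ) (s : ℂ) : Prop :=
  v ∈ A.degreePart d ∧ ∀ w ∈ M.degreePart h, M.mode v ((d : ℤ) - 1) w = s • w

variable {M}

theorem actsAsScalar_vac (h : ℂ) : M.ActsAsScalar h A.vac 0 1 := by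
  refine ⟨A.vac_mem_degreePart, fun w _ => ?_⟩
  simp [mode, M.vac_mode]

/-- Index, degree and scalar are free variables tied by equations, so that numerals such as 6 can
stand for 2 + 4. -/
theorem ActsAsScalar.shiftedMode_conf {h : ℂ} (hM : M.HasConformalWeight h)
    (hω : A.conf ∈ A.degreePart 2) {v : V} {d : ℕ} {s : ℂ} (hv : M.ActsAsScalar h v d s)
    (N : ℕ) (hN : 1 ≤ N) {n : ℤ} (hn : n = -N) {d' : ℕ} (hd : d' = d + N) {s' : ℂ}
    (hs : s' = (-1) ^ N * ((N - 1) * h + d) * s) :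
    M.ActsAsScalar h (A.shiftedMode A.conf n v) d' s' := by
  subst hn hd hs
  refine ⟨A.shiftedMode_mem_degreePart A.bracket_conf hv.1 (by push_cast; ring), fun w hw => ?_⟩
  rw [Nat.cast_add, M.zeroMode_conf hM hω hv.1 N hN hw, hv.2 w hw, smul_smul]

theorem ActsAsScalar.smul {h : ℂ} {v : V} {d : ℕ} {s : ℂ} (hv : M.ActsAsScalar h v d s) (a : ℂ) :
    M.ActsAsScalar h (a • v) d (a * s) :=
  ⟨Submodule.smul_mem _ _ hv.1, fun w hw => by
    have := hv.2 w hw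
    simp only [mode] at this
    simp [mode, this, mul_smul]⟩

theorem ActsAsScalar.add {h : ℂ} {v v' : V} {d : ℕ} {s s' : ℂ} (hv : M.ActsAsScalar h v d s)
    (hv' : M.ActsAsScalar h v' d s') : M.ActsAsScalar h (v + v') d (s + s') :=
  ⟨Submodule.add_mem _ hv.1 hv'.1, fun w hw => by
    have := hv.2 w hw
    have := hv'.2 w hw
    simp only [mode] at *
    simp [*, add_smul]⟩

theorem ActsAsScalar.traceO_eq {h : ℂ} {v : V} {d : ℕ} {s : ℂ} (hv : M.ActsAsScalar h v d s)
    (hv' : v ∈ A.degreePart d) :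
    M.traceO h hv' = s * Module.finrank ℂ (M.degreePart h) := by
  have := M.finiteDimensional h
  have : Module.Finite ℂ (M.degreePart h) := this
  rw [M.traceO_eq hv' (s • 1) (fun w => hv.2 w w.2), map_smul, LinearMap.trace_one, smul_eq_mul]

variable {h : ℂ} {x : V}

theorem zeroMode_shiftedMode_of_eq (hM : M.HasConformalWeight h) {v : V} {d : ℕ}
    (hx : x ∈ A.degreePart 2) (hv : v ∈ A.degreePart d) (N : ℕ) (hN : 1 ≤ N)
    {n k : ℤ} (hn : n = -N) (hk : k = d + N - 1) {w : W} (hw : w ∈ M.degreePart h) :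
    M.mode (A.shiftedMode x n v) k w =
      ((-1) ^ N : ℂ) • (((N : ℂ) - 1) • M.mode v ((d : ℤ) - 1) (M.mode x 1 w) -
        M.mode (A.shiftedMode x (-1) v) d w) := by
  subst hn hk
  exact M.zeroMode_shiftedMode hM hx hv N hN hw

theorem zeroMode_neg_three (hM : M.HasConformalWeight h) (hx : x ∈ A.degreePart 2)
    {w : W} (hw : w ∈ M.degreePart h) :
    M.mode (A.shiftedMode x (-3) A.vac) 2 w = (-2 : ℂ) • M.mode x 1 w := by
  rw [zeroMode_shiftedMode_of_eq hM hx A.vac_mem_degreePart 3 (by norm_num) (by norm_num)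
    (by norm_num) hw, A.shiftedMode_vac x le_rfl]
  have h1 : M.mode A.vac (((0 : ℕ) : ℤ) - 1) = 1 := (M.vac_mode _).trans (if_pos (by norm_num))
  have h2 : M.mode 0 ((0 : ℕ) : ℤ) w = 0 := by simp [mode]
  rw [h1, h2, sub_zero, Module.End.one_apply, smul_smul]
  norm_num

theorem zeroMode_neg_four (hM : M.HasConformalWeight h) (hx : x ∈ A.degreePart 2)
    {w : W} (hw : w ∈ M.degreePart h) :
    M.mode (A.shiftedMode x (-4) A.vac) 3 w = (3 : ℂ) • M.mode x 1 w := by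
  rw [zeroMode_shiftedMode_of_eq hM hx A.vac_mem_degreePart 4 (by norm_num) (by norm_num)
    (by norm_num) hw, A.shiftedMode_vac x le_rfl]
  have h1 : M.mode A.vac (((0 : ℕ) : ℤ) - 1) = 1 := (M.vac_mode _).trans (if_pos (by norm_num))
  have h2 : M.mode 0 ((0 : ℕ) : ℤ) w = 0 := by simp [mode]
  rw [h1, h2, sub_zero, Module.End.one_apply, smul_smul]
  norm_num

/-- The linear term is the correction -o(L'₋₁x), where L'₋₁x = L'₋₃1 has zero mode -2 o(x). -/
theorem zeroMode_neg_two_neg_two {e : ℂ} (hM : M.HasConformalWeight h)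
    (hx : x ∈ A.degreePart 2) (hP : VirasoroBracket (A.shiftedMode x) (A.shiftedMode x) e)
    {w : W} (hw : w ∈ M.degreePart h) :
    M.mode (A.shiftedMode x (-2) (A.shiftedMode x (-2) A.vac)) 3 w =
      M.mode x 1 (M.mode x 1 w) + (2 : ℂ) • M.mode x 1 w := by
  have h1 : A.shiftedMode x (-1) x = A.shiftedMode x (-3) A.vac := by
    have := hP (-1) (-2) A.vac
    rw [A.shiftedMode_vac x le_rfl, A.shiftedMode_neg_two_vac] at this
    rw [this]
    norm_num
  have h2 := zeroMode_neg_three hM hx hw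
  rw [A.shiftedMode_neg_two_vac, zeroMode_shiftedMode_of_eq hM hx hx 2 (by norm_num)
    (by norm_num) (by norm_num) hw, h1]
  simp only [Nat.cast_ofNat, h2]
  norm_num

/-- With N = d = 3 the zero mode is -(2 o(L'₋₃1)o(x) - 2 o(L'₋₄1)), where o(L'₋₃1) = -2 o(x) and
o(L'₋₄1) = 3 o(x). -/
theorem zeroMode_neg_three_neg_three {e : ℂ} (hM : M.HasConformalWeight h)
    (hx : x ∈ A.degreePart 2) (hx' : A.shiftedMode x (-3) A.vac ∈ A.degreePart 3)
    (hP : VirasoroBracket (A.shiftedMode x) (A.shiftedMode x) e)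
    {w : W} (hw : w ∈ M.degreePart h) :
    M.mode (A.shiftedMode x (-3) (A.shiftedMode x (-3) A.vac)) 5 w =
      (4 : ℂ) • M.mode x 1 (M.mode x 1 w) + (6 : ℂ) • M.mode x 1 w := by
  have h1 : A.shiftedMode x (-1) (A.shiftedMode x (-3) A.vac) =
      (2 : ℂ) • A.shiftedMode x (-4) A.vac := by
    have := hP (-1) (-3) A.vac
    rw [A.shiftedMode_vac x le_rfl] at this
    rw [this]
    norm_num
  have h2 := zeroMode_neg_four hM hx hw
  have h3 := zeroMode_neg_three hM hx (M.mode_mem_degreePart hx w hw)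
  rw [zeroMode_shiftedMode_of_eq hM hx hx' 3 (by norm_num) (by norm_num) (by norm_num) hw, h1]
  simp only [mode] at h2 h3
  norm_num at h3
  simp [mode, h2, h3]
  module

end VOAModule

/-! ### The proposition -/

theorem proposition4p4 {V W ι : Type*} [AddCommGroup V] [Module ℂ V] [AddCommGroup W] [Module ℂ W]
    (A : VOA V) (D : A.HighestWeightDecomposition ι)
    (hc₁ : A.c ≠ -24) (hc₂ : A.c ≠ -15) (hc₃ : A.c ≠ -44 / 5) (hc₄ : A.c ≠ 34 / 35)
    (hc₅ : A.c ≠ 1)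
    (ω' : V) (e : ℂ)
    (hω' : ω' ∈ A.degreePart 2) (hω'' : A.conf - ω' ∈ A.degreePart 2)
    (hvir' : A.IsVirasoroElement ω' e) (hvir'' : A.IsVirasoroElement (A.conf - ω') (A.c - e))
    (hcomm : A.Commuting (A.generatedBy {ω'}) (A.generatedBy {A.conf - ω'}))
    (he₁ : e ≠ -68 / 7) (he₂ : e ≠ -22 / 5) (he₃ : e ≠ 0)
    (hf₁ : A.c - e ≠ -68 / 7) (hf₂ : A.c - e ≠ -22 / 5) (hf₃ : A.c - e ≠ 0)
    (hsimple' : e = 1 / 2 → A.IsSimpleSubalgebra (A.generatedBy {ω'}))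
    (hsimple'' : e = A.c - 1 / 2 → A.IsSimpleSubalgebra (A.generatedBy {A.conf - ω'}))
    (M : VOAModule A W) (h : ℂ) (hM : M.HasConformalWeight h) (hh : h ≠ 0)
    (hdesign : M.IsConformalDesign D h 6) :
    4 + 7 * A.c + A.c ^ 2 - 124 * h - 31 * A.c * h + 248 * h ^ 2 = 0 := by
  have hω : A.conf ∈ A.degreePart 2 := by simpa using Submodule.add_mem _ hω' hω''
  have hP := hvir'.bracket
  have hLP := VOA.bracket_conf_of_commuting hvir' hcomm
  have hx3 : A.shiftedMode ω' (-3) A.vac ∈ A.degreePart 3 :=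
    VOA.shiftedMode_mem_degreePart hLP A.vac_mem_degreePart (by norm_num)
  have hx4 : A.shiftedMode ω' (-2) (A.shiftedMode ω' (-2) A.vac) ∈ A.degreePart 4 := by
    rw [A.shiftedMode_neg_two_vac]
    exact VOA.shiftedMode_mem_degreePart hLP hω' (by norm_num)
  have hx6 : A.shiftedMode ω' (-3) (A.shiftedMode ω' (-3) A.vac) ∈ A.degreePart 6 :=
    VOA.shiftedMode_mem_degreePart hLP hx3 (by norm_num)
  obtain ⟨a, ha, e2⟩ := D.exists_proj_two hLP hω'
  obtain ⟨α, β, hαβ, e4, e4'⟩ := D.exists_proj_four hLP hP hx4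
  obtain ⟨a₁, a₂, a₃, a₄, hγ, e6, e6', e6'', e6'''⟩ := D.exists_proj_six hLP hP hx6
  have s0 := VOAModule.actsAsScalar_vac (M := M) h
  -- Each step L₋ₙ on degree d contributes the factor (-1)ⁿ((n-1)h + d), starting from the scalar 1
  -- of the vacuum.
  have s2 := s0.shiftedMode_conf hM hω 2 (n := -2) (d' := 2) (s' := h)
    (by norm_num) (by norm_num) (by norm_num) (by push_cast; ring)
  have s3 := s0.shiftedMode_conf hM hω 3 (n := -3) (d' := 3) (s' := -2 * h)
    (by norm_num) (by norm_num) (by norm_num) (by push_cast; ring)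
  have s4 := s0.shiftedMode_conf hM hω 4 (n := -4) (d' := 4) (s' := 3 * h)
    (by norm_num) (by norm_num) (by norm_num) (by push_cast; ring)
  have s6 := s0.shiftedMode_conf hM hω 6 (n := -6) (d' := 6) (s' := 5 * h)
    (by norm_num) (by norm_num) (by norm_num) (by push_cast; ring)
  have s22 := s2.shiftedMode_conf hM hω 2 (n := -2) (d' := 4) (s' := (h + 2) * h)
    (by norm_num) (by norm_num) (by norm_num) (by push_cast; ring)
  have s42 := s2.shiftedMode_conf hM hω 4 (n := -4) (d' := 6) (s' := (3 * h + 2) * h)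
    (by norm_num) (by norm_num) (by norm_num) (by push_cast; ring)
  have s33 := s3.shiftedMode_conf hM hω 3 (n := -3) (d' := 6) (s' := (4 * h + 6) * h)
    (by norm_num) (by norm_num) (by norm_num) (by push_cast; ring)
  have s222 := s22.shiftedMode_conf hM hω 2 (n := -2) (d' := 6) (s' := (h + 4) * ((h + 2) * h))
    (by norm_num) (by norm_num) (by norm_num) (by push_cast; ring)
  have d2 := hdesign 2 (by norm_num) _ hω'
  have d4 := hdesign 4 (by norm_num) _ hx4
  have d6 := hdesign 6 (by norm_num) _ hx6
  have p2 := s2.smul a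
  have p4 := (s4.smul α).add (s22.smul β)
  have p6 := (s6.smul a₁).add ((s42.smul a₂).add ((s33.smul a₃).add (s222.smul a₄)))
  -- The scalar actions now concern the projections themselves, hence the right-hand sides of the
  -- design equations.
  rw [← ha] at p2
  rw [← hαβ] at p4
  rw [← hγ] at p6
  rw [p2.traceO_eq] at d2
  rw [p4.traceO_eq] at d4
  rw [p6.traceO_eq] at d6
  set T : Module.End ℂ (M.degreePart h) :=
    (M.mode ω' ((2 : ℕ) - 1 : ℤ)).restrict (M.mode_mem_degreePart hω') with hT
  have hTw : ∀ w : M.degreePart h, (T w : W) = M.mode ω' 1 w := fun w => rfl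
  have t2 : M.traceO h hω' = LinearMap.trace ℂ _ T := rfl
  have t4 : M.traceO h hx4 = LinearMap.trace ℂ _ (T * T) + 2 * LinearMap.trace ℂ _ T := by
    rw [M.traceO_eq hx4 (T * T + (2 : ℂ) • T), map_add, map_smul, smul_eq_mul]
    intro w
    exact VOAModule.zeroMode_neg_two_neg_two hM hω' hP w.2
  have t6 : M.traceO h hx6 = 4 * LinearMap.trace ℂ _ (T * T) + 6 * LinearMap.trace ℂ _ T := by
    rw [M.traceO_eq hx6 ((4 : ℂ) • (T * T) + (6 : ℂ) • T), map_add, map_smul, map_smul,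
      smul_eq_mul, smul_eq_mul]
    intro w
    exact VOAModule.zeroMode_neg_three_neg_three hM hω' hx3 hP w.2
  have hfin : Module.Finite ℂ (M.degreePart h) := M.finiteDimensional h
  have hd : (Module.finrank ℂ (M.degreePart h) : ℂ) ≠ 0 := by
    rw [Nat.cast_ne_zero]
    exact fun h0 => hM.2 (Submodule.finrank_eq_zero.1 h0)
  have key := quadratic_relation e2 e4 e4' e6 e6' e6'' e6''' (t2.symm.trans d2)
    (t4.symm.trans d4) (t6.symm.trans d6)
  refine (mul_eq_zero.1 key).resolve_left ?_
  -- The cofactor 4he(c-e) dim W_h is nonzero; its vanishing at e = 0 and e = c reflects the trivial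
  -- splittings of ω.
  exact mul_ne_zero (mul_ne_zero (mul_ne_zero (mul_ne_zero (by norm_num) hh) he₃) hf₃) hd

end
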